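/- Let $\mathbb{A}^2_* = \mathrm{Spec}(\mathbb{C}[x,y]) \setminus \{(0,0)\}$ be the punctured complex affine plane. For integers $m,n\ge 1$ let $$X_{m,n}=\{x^m v-y^n u=1\}\subset \mathbb{A}^2_*\times\mathbb{A}^2,\qquad \mathbb{A}^2=\mathrm{Spec}(\mathbb{C}[u,v]),$$ regarded as an $\mathbb{A}^1$-bundle over $\mathbb{A}^2_*$ through the projection $\rho_{m,n}:X_{m,n}\to\mathbb{A}^2_*$, $(x,y,u,v)\mapsto(x,y)$. Then, for all integers $m,n,p,q\ge 1$, the bundles $\rho_{m,n}:X_{m,n}\to\mathbb{A}^2_*$ and $\rho_{p,q}:X_{p,q}\to\mathbb{A}^2_*$ are obtained from each other by base change along an automorphism of $\mathbb{A}^2_*$, that is, there exist an automorphism $\psi:\mathbb{A}^2_*\to\mathbb{A}^2_*$ over $\mathbb{C}$ and a morphism $\Psi:X_{m,n}\to X_{p,q}$ such that the square with $\rho_{p,q}\circ\Psi=\psi\circ\rho_{m,n}$ is cartesian (equivalently, such that this square commutes and $\Psi$ is an isomorphism), if and only if $\{m,n\}=\{p,q\}$. -/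

import Mathlib

open CategoryTheory AlgebraicGeometry

noncomputable section

namespace PuncturedPlane

/-- The coordinate ring `ℂ[x, y]` of the affine plane, with `x = X 0` and `y = X 1`. -/
abbrev PlaneRing : Type := MvPolynomial (Fin 2) ℂ

/-- The affine plane `𝔸² = Spec ℂ[x, y]` over the complex numbers. -/
abbrev plane : Scheme := Spec (CommRingCat.of PlaneRing)

/-- The complement of the origin `{x = y = 0}`, as an open subset of `𝔸²`. -/
def puncturedOpen : plane.Opens where
  carrier := (PrimeSpectrum.zeroLocus {(MvPolynomial.X 0 : PlaneRing), MvPolynomial.X 1})ᶜ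
  is_open' := (PrimeSpectrum.isClosed_zeroLocus _).isOpen_compl

/-- The punctured affine plane `𝔸²_*`. -/
abbrev puncturedPlane : Scheme := puncturedOpen.toScheme

/-- The structure morphism `𝔸²_* ⟶ Spec ℂ`. -/
def structureMap : puncturedPlane ⟶ Spec (CommRingCat.of ℂ) :=
  puncturedOpen.ι ≫ Spec.map (CommRingCat.ofHom (MvPolynomial.C : ℂ →+* PlaneRing))

/-- The polynomial `x ^ m * v - y ^ n * u - 1` in `ℂ[x, y][u, v]`,
with `u = X 0` and `v = X 1` the outer variables. -/
def equation (m n : ℕ) : MvPolynomial (Fin 2) PlaneRing :=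
  MvPolynomial.C (MvPolynomial.X 0 ^ m) * MvPolynomial.X 1
    - MvPolynomial.C (MvPolynomial.X 1 ^ n) * MvPolynomial.X 0 - 1

/-- The ring `ℂ[x, y][u, v] / (x ^ m * v - y ^ n * u - 1)`, a `ℂ[x, y]`-algebra. -/
abbrev BundleRing (m n : ℕ) : Type :=
  MvPolynomial (Fin 2) PlaneRing ⧸ Ideal.span {equation m n}

/-- The projection `(x, y, u, v) ↦ (x, y)` from the closed subscheme
`{x ^ m * v - y ^ n * u = 1}` of `𝔸² × 𝔸²` to the first factor. -/
def projection (m n : ℕ) : Spec (CommRingCat.of (BundleRing m n)) ⟶ plane :=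
  Spec.map (CommRingCat.ofHom (algebraMap PlaneRing (BundleRing m n)))

/-- The scheme `X_{m,n} = {x ^ m * v - y ^ n * u = 1} ⊆ 𝔸²_* × 𝔸²`. -/
abbrev totalSpace (m n : ℕ) : Scheme := (projection m n ⁻¹ᵁ puncturedOpen).toScheme

/-- The bundle projection `ρ : X_{m,n} ⟶ 𝔸²_*`, `(x, y, u, v) ↦ (x, y)`. -/
def bundleMap (m n : ℕ) : totalSpace m n ⟶ puncturedPlane :=
  projection m n ∣_ puncturedOpen

/-- `ρ : X ⟶ 𝔸²_*` is obtained from `ρ' : X' ⟶ 𝔸²_*` by base change along some automorphism `ψ`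
of the complex variety `𝔸²_*`: there is a cartesian square
```
X  ---Ψ---> X'
|ρ          |ρ'
v           v
𝔸²_* --ψ--> 𝔸²_*
```
As `ψ` is invertible, so is `Ψ`, and the relation is symmetric (use `ψ⁻¹` and `Ψ⁻¹`). -/
def IsBaseChangeByAut {X X' : Scheme} (ρ : X ⟶ puncturedPlane) (ρ' : X' ⟶ puncturedPlane) :
    Prop :=
  ∃ ψ : puncturedPlane ≅ puncturedPlane, ψ.hom ≫ structureMap = structureMap ∧
    ∃ Ψ : X ⟶ X', IsPullback Ψ ρ ρ' ψ.hom

end PuncturedPlane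

end

/-! Write `A = ℂ[x, y]`, `f = x ^ m`, `g = y ^ n`. The relation `f v - g u = 1` keeps `f` and `g`
from vanishing together, so the total space is the affine scheme of `A[u, v] / (f v - g u - 1)`. By
Hartogs, `A` is also the ring of functions on the punctured plane. A base change therefore yields an
automorphism `φ` of `A` and a `φ`-semilinear isomorphism of the two torsor rings.

The invariant is the ideal `(f, g)`. The fibre coordinates `u / f` and `v / g` on the two charts
differ by `1 / (f g)`, so a function `α X + β` of fibre degree at most one satisfies `α / (f g) ∈
A_f + A_g` with `α ∈ A`; coprimality then forces `α ∈ (f, g)`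
(`TorsorRing.exists_mem_span_of_toPoly_eq`). Over `Frac A` a semilinear isomorphism of `K[X]` is
affine in `X`, and its leading coefficient turns out to be a unit of `A`. Comparing leading
coefficients of the images of `u` and `v`, in both directions, gives `φ (f', g') = (f, g)`
(`TorsorRing.map_span_eq`).

It remains to recover `{m, n}` from `I = (x ^ m, y ^ n)` up to automorphism. Taking radicals, `φ`
preserves the ideal `M` of the origin. The least `k` with `M ^ k ≤ I` is `m + n - 1`, and the
largest `k` with `I ≤ M ^ k` is `min m n`; sum and minimum determine the pair. Conversely,
exchanging `x` and `y` realises the swap of exponents. -/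

namespace PuncturedPlane

/-! ### Torsor rings and their ideals of leading coefficients. -/

section Algebra

open Polynomial

variable {A : Type*} [CommRing A]

/-- The ring `A[u, v] / (f * v - g * u - 1)`. -/
abbrev TorsorRing (f g : A) : Type _ :=
  MvPolynomial (Fin 2) A ⧸ Ideal.span {MvPolynomial.C f * MvPolynomial.X 1
    - MvPolynomial.C g * MvPolynomial.X 0 - (1 : MvPolynomial (Fin 2) A)}

/-- The class of `u` or `v` in `A[u, v] / (f * v - g * u - 1)`. -/
noncomputable def TorsorRing.coord (f g : A) (i : Fin 2) : TorsorRing f g :=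
  Ideal.Quotient.mk _ (MvPolynomial.X i)

theorem TorsorRing.relation (f g : A) :
    algebraMap A (TorsorRing f g) f * coord f g 1 - algebraMap A (TorsorRing f g) g * coord f g 0
      = 1 := by
  have h : Ideal.Quotient.mk (Ideal.span {MvPolynomial.C f * MvPolynomial.X 1
      - MvPolynomial.C g * MvPolynomial.X 0 - (1 : MvPolynomial (Fin 2) A)})
      (MvPolynomial.C f * MvPolynomial.X 1
      - MvPolynomial.C g * MvPolynomial.X 0 - (1 : MvPolynomial (Fin 2) A)) = 0 :=
    Ideal.Quotient.eq_zero_iff_mem.2 (Ideal.subset_span rfl)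
  rw [map_sub, map_one, sub_eq_zero, map_sub, map_mul, map_mul] at h
  exact h

theorem TorsorRing.ringHom_ext {f g : A} {S : Type*} [CommRing S] {h₁ h₂ : TorsorRing f g →+* S}
    (h : ∀ a, h₁ (algebraMap A _ a) = h₂ (algebraMap A _ a))
    (hX : ∀ i, h₁ (coord f g i) = h₂ (coord f g i)) : h₁ = h₂ := by
  refine Ideal.Quotient.ringHom_ext (MvPolynomial.ringHom_ext h hX)

/-- Ring homomorphisms out of `A[u, v] / (f * v - g * u - 1)`. -/
noncomputable def TorsorRing.lift {f g : A} {S : Type*} [CommRing S] (h : A →+* S) (c : Fin 2 → S)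
    (hc : h f * c 1 - h g * c 0 = 1) : TorsorRing f g →+* S :=
  Ideal.Quotient.lift _ (MvPolynomial.eval₂Hom h c) (fun a ha => by
    refine (Ideal.span_le.2 ?_ : _ ≤ RingHom.ker (MvPolynomial.eval₂Hom h c)) ha
    simp [Set.singleton_subset_iff, RingHom.mem_ker, hc])

@[simp]
theorem TorsorRing.lift_algebraMap {f g : A} {S : Type*} [CommRing S] (h : A →+* S)
    (c : Fin 2 → S) (hc : h f * c 1 - h g * c 0 = 1) (a : A) :
    lift h c hc (algebraMap A _ a) = h a :=
  MvPolynomial.eval₂_C h c a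

@[simp]
theorem TorsorRing.lift_coord {f g : A} {S : Type*} [CommRing S] (h : A →+* S)
    (c : Fin 2 → S) (hc : h f * c 1 - h g * c 0 = 1) (i : Fin 2) :
    lift h c hc (coord f g i) = c i :=
  MvPolynomial.eval₂_X h c i

theorem TorsorRing.induction {f g : A} {P : TorsorRing f g → Prop}
    (hC : ∀ a, P (algebraMap A _ a)) (hX : ∀ i, P (coord f g i))
    (hadd : ∀ a b, P a → P b → P (a + b)) (hmul : ∀ a b, P a → P b → P (a * b)) (b) : P b := by
  obtain ⟨b, rfl⟩ := Ideal.Quotient.mk_surjective b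
  induction b using MvPolynomial.induction_on with
  | C a => exact hC a
  | add p q hp hq => rw [map_add]; exact hadd _ _ hp hq
  | mul_X p i hp => rw [map_mul]; exact hmul _ _ hp (hX i)

section Denominators

variable {K : Type*} [Field K] [Algebra A K]

/-- A polynomial over `K` whose coefficients become elements of `A` after multiplication with a
common power of `f`. -/
def HasDenominator (f : A) (P : K[X]) : Prop :=
  ∃ (k : ℕ) (Q : A[X]), C (algebraMap A K f ^ k) * P = Q.map (algebraMap A K)

theorem HasDenominator.add {f : A} {P Q : K[X]} (hP : HasDenominator f P)
    (hQ : HasDenominator f Q) : HasDenominator f (P + Q) := by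
  obtain ⟨k, P', hP⟩ := hP
  obtain ⟨l, Q', hQ⟩ := hQ
  refine ⟨k + l, C (f ^ l) * P' + C (f ^ k) * Q', ?_⟩
  simp only [Polynomial.map_add, Polynomial.map_mul, ← hP, ← hQ, Polynomial.map_C, map_pow,
    Polynomial.map_pow]
  ring

theorem HasDenominator.mul {f : A} {P Q : K[X]} (hP : HasDenominator f P)
    (hQ : HasDenominator f Q) : HasDenominator f (P * Q) := by
  obtain ⟨k, P', hP⟩ := hP
  obtain ⟨l, Q', hQ⟩ := hQ
  refine ⟨k + l, P' * Q', ?_⟩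
  simp only [Polynomial.map_mul, ← hP, ← hQ, map_pow]
  ring

theorem hasDenominator_map (f : A) (Q : A[X]) : HasDenominator f (Q.map (algebraMap A K)) :=
  ⟨0, Q, by simp⟩

theorem hasDenominator_inv {f : A} (hf : algebraMap A K f ≠ 0) :
    HasDenominator f (C (algebraMap A K f)⁻¹) :=
  ⟨1, 1, by simp [← C_mul, hf]⟩

theorem HasDenominator.neg {f : A} {P : K[X]} (hP : HasDenominator f P) :
    HasDenominator f (-P) := by
  obtain ⟨k, P', hP⟩ := hP
  exact ⟨k, -P', by simp [← hP]⟩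

theorem HasDenominator.exists_coeff {f : A} {α β : K} (h : HasDenominator f (C α * X + C β)) :
    ∃ (k : ℕ) (a b : A), algebraMap A K f ^ (k + 1) * α = algebraMap A K a ∧
      algebraMap A K f ^ (k + 1) * β = algebraMap A K b := by
  obtain ⟨k, Q, hQ⟩ := h
  -- One spare factor `f` makes the exponent positive, so that `1 / (f g)` can later be cleared
  -- without subtracting exponents.
  refine ⟨k, f * Q.coeff 1, f * Q.coeff 0, ?_, ?_⟩
  · rw [map_mul, ← coeff_map, ← hQ, coeff_C_mul]
    simp; ring
  · rw [map_mul, ← coeff_map, ← hQ, coeff_C_mul]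
    simp; ring

end Denominators

section Comparison

variable {K : Type*} [Field K] [Algebra A K]

/-- The trivialisation of `A[u, v] / (f * v - g * u - 1)` over `K`, in the fibre coordinate
`u / f`. -/
noncomputable def TorsorRing.toPoly {f : A} (g : A) (hf : algebraMap A K f ≠ 0) :
    TorsorRing f g →+* K[X] :=
  TorsorRing.lift (C.comp (algebraMap A K))
    ![C (algebraMap A K f) * X, C (algebraMap A K f)⁻¹ + C (algebraMap A K g) * X] (by
      have : C (algebraMap A K f) * C (algebraMap A K f)⁻¹ = 1 := by
        rw [← C_mul, mul_inv_cancel₀ hf, C_1]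
      simp only [RingHom.comp_apply, Matrix.cons_val_zero, Matrix.cons_val_one, mul_add, this]
      ring)

@[simp]
theorem TorsorRing.toPoly_algebraMap {f : A} (g : A) (hf : algebraMap A K f ≠ 0) (a : A) :
    toPoly g hf (algebraMap A _ a) = C (algebraMap A K a) := by
  simp [toPoly]

@[simp]
theorem TorsorRing.toPoly_coord_zero {f : A} (g : A) (hf : algebraMap A K f ≠ 0) :
    toPoly g hf (coord f g 0) = C (algebraMap A K f) * X := by
  simp [toPoly]

@[simp]
theorem TorsorRing.toPoly_coord_one {f : A} (g : A) (hf : algebraMap A K f ≠ 0) :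
    toPoly g hf (coord f g 1) = C (algebraMap A K f)⁻¹ + C (algebraMap A K g) * X := by
  simp [toPoly]

theorem TorsorRing.hasDenominator_toPoly {f : A} (g : A) (hf : algebraMap A K f ≠ 0)
    (b : TorsorRing f g) : HasDenominator f (toPoly g hf b) := by
  induction b using TorsorRing.induction with
  | hC a => simpa using hasDenominator_map (K := K) f (C a)
  | hX i =>
    fin_cases i
    · rw [Fin.zero_eta, toPoly_coord_zero]
      exact ⟨0, C f * X, by simp⟩
    · rw [Fin.mk_one, toPoly_coord_one]
      refine (hasDenominator_inv hf).add ⟨0, C g * X, by simp⟩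
  | hadd a b ha hb => rw [map_add]; exact ha.add hb
  | hmul a b ha hb => rw [map_mul]; exact ha.mul hb

/-- The substitution passes from the fibre coordinate `u / f` to `v / g = u / f + 1 / (f g)`. There
`v` becomes `g X` and `u` becomes `f X - 1 / g`, so only `g` is inverted. -/
theorem TorsorRing.hasDenominator_toPoly_comp {f g : A} (hf : algebraMap A K f ≠ 0)
    (hg : algebraMap A K g ≠ 0) (b : TorsorRing f g) :
    HasDenominator g ((toPoly g hf b).comp
      (X - C ((algebraMap A K f)⁻¹ * (algebraMap A K g)⁻¹))) := by
  induction b using TorsorRing.induction with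
  | hC a => simpa using hasDenominator_map (K := K) g (C a)
  | hX i =>
    fin_cases i
    · have h := (hasDenominator_map (K := K) g (C f * X)).add (hasDenominator_inv hg).neg
      have e : C (algebraMap A K f) * C (algebraMap A K f)⁻¹ = 1 := by
        rw [← C_mul, mul_inv_cancel₀ hf, C_1]
      convert h using 1
      simp only [Fin.zero_eta, toPoly_coord_zero, mul_comp, C_comp, X_comp, Polynomial.map_mul,
        map_C, map_X, C_mul]
      linear_combination (-C (algebraMap A K g)⁻¹) * e
    · have e : C (algebraMap A K g) * C (algebraMap A K g)⁻¹ = 1 := by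
        rw [← C_mul, mul_inv_cancel₀ hg, C_1]
      convert hasDenominator_map (K := K) g (C g * X) using 1
      simp only [Fin.mk_one, toPoly_coord_one, add_comp, mul_comp, C_comp, X_comp,
        Polynomial.map_mul, map_C, map_X, C_mul]
      linear_combination (-C (algebraMap A K f)⁻¹) * e
  | hadd a b ha hb => rw [map_add, add_comp]; exact ha.add hb
  | hmul a b ha hb => rw [map_mul, mul_comp]; exact ha.mul hb

/-- The linear functions on the torsor have leading coefficient in the ideal `(f, g)`. -/
theorem TorsorRing.exists_mem_span_of_toPoly_eq [IsDomain A] [DecompositionMonoid A]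
    [IsFractionRing A K] {f g : A} (hf : algebraMap A K f ≠ 0) (hg : algebraMap A K g ≠ 0)
    (hfg : IsRelPrime f g) {b : TorsorRing f g} {α β : K}
    (hb : toPoly g hf b = C α * X + C β) :
    ∃ a ∈ Ideal.span {f, g}, algebraMap A K a = α := by
  have h₁ := hasDenominator_toPoly g hf b
  have h₂ := hasDenominator_toPoly_comp hf hg b
  have e : (toPoly g hf b).comp (X - C ((algebraMap A K f)⁻¹ * (algebraMap A K g)⁻¹)) =
      C α * X + C (β - α * ((algebraMap A K f)⁻¹ * (algebraMap A K g)⁻¹)) := by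
    rw [hb]
    simp only [add_comp, mul_comp, C_comp, X_comp, C_sub, C_mul]
    ring
  rw [hb] at h₁
  rw [e] at h₂
  obtain ⟨k, a₁, b₁, ha₁, hb₁⟩ := h₁.exists_coeff
  obtain ⟨l, a₂, b₂, ha₂, hb₂⟩ := h₂.exists_coeff
  have inj := IsFractionRing.injective A K
  have hf0 : f ≠ 0 := by rintro rfl; simp at hf
  have hg0 : g ≠ 0 := by rintro rfl; simp at hg
  -- This is `A_f ∩ A_g = A`, applied to `α`.
  have hdvd : f ^ (k + 1) ∣ a₁ := by
    refine (hfg.pow (m := k + 1) (n := l + 1)).dvd_of_dvd_mul_left ⟨a₂, inj ?_⟩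
    simp only [map_mul, map_pow, ← ha₁, ← ha₂]
    ring
  obtain ⟨a, rfl⟩ := hdvd
  have ha : algebraMap A K a = α := by
    rw [map_mul, map_pow] at ha₁
    exact (mul_left_cancel₀ (pow_ne_zero _ hf) ha₁).symm
  refine ⟨a, ?_, ha⟩
  -- The two constant terms differ by `α / (f g)`; this is that identity multiplied by `f ^ (k + 1)
  -- * g ^ (l + 1)`.
  have key : f ^ k * g ^ l * a = g ^ (l + 1) * b₁ - f ^ (k + 1) * b₂ := by
    apply inj
    simp only [map_mul, map_pow, map_sub, ← hb₁, ← hb₂, ha]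
    field_simp
    ring
  have d₁ : f ^ k ∣ b₁ := by
    refine (hfg.pow (m := k) (n := l + 1)).dvd_of_dvd_mul_left
      ⟨g ^ l * a + f * b₂, ?_⟩
    linear_combination -key
  have d₂ : g ^ l ∣ b₂ := by
    refine (hfg.pow (m := k + 1) (n := l)).symm.dvd_of_dvd_mul_left
      ⟨g * b₁ - f ^ k * a, ?_⟩
    linear_combination key
  obtain ⟨c₁, rfl⟩ := d₁
  obtain ⟨c₂, rfl⟩ := d₂
  have : a = (-c₂) * f + c₁ * g := by
    refine mul_left_cancel₀ (mul_ne_zero (pow_ne_zero k hf0) (pow_ne_zero l hg0)) ?_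
    rw [key]
    ring
  exact Ideal.mem_span_pair.2 ⟨_, _, this.symm⟩

/-- A homomorphism of torsor rings over `φ` extends to the trivialisations over the fraction
field. -/
theorem TorsorRing.exists_extension {f g f' g' : A} (hf : algebraMap A K f ≠ 0)
    (hf' : algebraMap A K f' ≠ 0) {φ : A →+* A} {φK : K →+* K}
    (hφ : ∀ a, φK (algebraMap A K a) = algebraMap A K (φ a))
    {Φ : TorsorRing f' g' →+* TorsorRing f g}
    (hΦ : ∀ a, Φ (algebraMap A _ a) = algebraMap A _ (φ a)) :
    ∃ T : K[X], (eval₂RingHom (C.comp φK) T).comp (toPoly g' hf') = (toPoly g hf).comp Φ := by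
  have hinv : C (algebraMap A K (φ f')) * C (algebraMap A K (φ f'))⁻¹ = 1 := by
    rw [← C_mul, mul_inv_cancel₀, C_1]
    rw [← hφ]
    exact (map_ne_zero φK).2 hf'
  have hrel := congrArg (fun b => toPoly g hf (Φ b)) (TorsorRing.relation f' g')
  simp only [map_sub, map_mul, hΦ, toPoly_algebraMap, map_one] at hrel
  -- `T` is forced to be the image of the fibre coordinate `u' / f'`; compatibility on `v'` then
  -- follows from the relation.
  refine ⟨C (algebraMap A K (φ f'))⁻¹ * toPoly g hf (Φ (coord f' g' 0)), ?_⟩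
  refine ringHom_ext (fun a => by simp [hΦ, hφ]) (fun i => ?_)
  fin_cases i
  · simp [hφ, ← mul_assoc, hinv]
  · simp only [Fin.mk_one, RingHom.comp_apply, toPoly_coord_one, coe_eval₂RingHom, eval₂_add,
      eval₂_mul, eval₂_C, eval₂_X, map_inv₀, hφ]
    linear_combination (-C (algebraMap A K (φ f'))⁻¹) * hrel +
      toPoly g hf (Φ (coord f' g' 1)) * hinv

/-- The images of `u'` and `v'` are affine in `X` with leading coefficients `φ f' * α` and `φ g' *
α`, which therefore lie in `(f, g)`. Since `φ f'` and `φ g'` are coprime, `α` itself lies in `A`. -/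
theorem TorsorRing.exists_multiplier [IsDomain A] [DecompositionMonoid A] [IsFractionRing A K]
    {f g f' g' : A} (hf : algebraMap A K f ≠ 0) (hg : algebraMap A K g ≠ 0)
    (hf' : algebraMap A K f' ≠ 0) (hfg : IsRelPrime f g) {φ : A →+* A} {φK : K →+* K}
    (hφ : ∀ a, φK (algebraMap A K a) = algebraMap A K (φ a)) (hfg' : IsRelPrime (φ f') (φ g'))
    {Φ : TorsorRing f' g' →+* TorsorRing f g} {α β : K}
    (hT : (eval₂RingHom (C.comp φK) (C α * X + C β)).comp (toPoly g' hf') =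
      (toPoly g hf).comp Φ) :
    ∃ a : A, algebraMap A K a = α ∧ a * φ f' ∈ Ideal.span {f, g} ∧
      a * φ g' ∈ Ideal.span {f, g} := by
  have h₀ := RingHom.congr_fun hT (coord f' g' 0)
  have h₁ := RingHom.congr_fun hT (coord f' g' 1)
  simp only [RingHom.comp_apply, toPoly_coord_zero, toPoly_coord_one, coe_eval₂RingHom, eval₂_add,
    eval₂_mul, eval₂_C, eval₂_X, hφ] at h₀ h₁
  obtain ⟨a₀, ha₀, e₀⟩ := exists_mem_span_of_toPoly_eq hf hg hfg
    (b := Φ (coord f' g' 0)) (α := algebraMap A K (φ f') * α) (β := algebraMap A K (φ f') * β)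
    (by rw [← h₀]; simp only [C_mul]; ring)
  obtain ⟨a₁, ha₁, e₁⟩ := exists_mem_span_of_toPoly_eq hf hg hfg
    (b := Φ (coord f' g' 1)) (α := algebraMap A K (φ g') * α)
    (β := φK (algebraMap A K f')⁻¹ + algebraMap A K (φ g') * β)
    (by rw [← h₁]; simp only [C_mul, C_add]; ring)
  have inj := IsFractionRing.injective A K
  have hdvd : φ f' ∣ a₀ := by
    refine hfg'.dvd_of_dvd_mul_left ⟨a₁, inj ?_⟩
    rw [map_mul, map_mul, e₀, e₁]
    ring
  obtain ⟨a, rfl⟩ := hdvd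
  have hφf : algebraMap A K (φ f') ≠ 0 := by
    rw [← hφ]
    exact (map_ne_zero φK).2 hf'
  have ha : algebraMap A K a = α := by
    rw [map_mul] at e₀
    exact mul_left_cancel₀ hφf e₀
  refine ⟨a, ha, by rwa [mul_comm], ?_⟩
  convert ha₁
  apply inj
  rw [map_mul, ha, e₁, mul_comm]

/-- Isomorphic torsor rings have the same ideals of leading coefficients. -/
theorem TorsorRing.map_span_eq [IsDomain A] [DecompositionMonoid A] {f g f' g' : A}
    (hf0 : f ≠ 0) (hg0 : g ≠ 0) (hf0' : f' ≠ 0) (hg0' : g' ≠ 0)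
    (hfg : IsRelPrime f g) (hfg' : IsRelPrime f' g') (φ : A ≃+* A)
    (Φ : TorsorRing f' g' ≃+* TorsorRing f g)
    (hΦ : ∀ a, Φ (algebraMap A _ a) = algebraMap A _ (φ a)) :
    Ideal.map φ (Ideal.span {f', g'}) = Ideal.span {f, g} := by
  let K := FractionRing A
  have inj := IsFractionRing.injective A K
  have ne : ∀ {a : A}, a ≠ 0 → algebraMap A K a ≠ 0 := fun h =>
    (map_ne_zero_iff _ inj).2 h
  have relPrime_map : ∀ (e : A ≃+* A) {a b : A}, IsRelPrime a b → IsRelPrime (e a) (e b) := by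
    intro e a b hab d hda hdb
    have := hab (d := e.symm d) (by simpa using map_dvd e.symm hda)
      (by simpa using map_dvd e.symm hdb)
    simpa using this.map e
  let φK : K ≃+* K := IsFractionRing.ringEquivOfRingEquiv φ
  have hφ : ∀ a, φK (algebraMap A K a) = algebraMap A K (φ a) := fun a =>
    IsFractionRing.ringEquivOfRingEquiv_algebraMap φ a
  have hφs : ∀ a, φK.symm (algebraMap A K a) = algebraMap A K (φ.symm a) := fun a => by
    rw [RingEquiv.symm_apply_eq, hφ, RingEquiv.apply_symm_apply]
  have hΦs : ∀ a, Φ.symm (algebraMap A _ a) = algebraMap A _ (φ.symm a) := fun a => by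
    rw [RingEquiv.symm_apply_eq, hΦ, RingEquiv.apply_symm_apply]
  obtain ⟨T, hT⟩ := exists_extension (K := K) (φ := φ.toRingHom) (φK := φK.toRingHom)
    (Φ := Φ.toRingHom) (ne hf0) (ne hf0') hφ hΦ
  obtain ⟨S, hS⟩ := exists_extension (K := K) (φ := φ.symm.toRingHom) (φK := φK.symm.toRingHom)
    (Φ := Φ.symm.toRingHom) (ne hf0') (ne hf0) hφs hΦs
  -- The extensions are mutually inverse: evaluate the round trip at `u'`, which is `f' X`, and
  -- cancel `f'`.
  have hST : eval₂ (C.comp φK.symm.toRingHom) S T = X := by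
    have h := RingHom.congr_fun hT (coord f' g' 0)
    have h' := RingHom.congr_fun hS (Φ (coord f' g' 0))
    change _ = toPoly g (ne hf0) (Φ (coord f' g' 0)) at h
    change eval₂RingHom (C.comp φK.symm.toRingHom) S (toPoly g (ne hf0) (Φ (coord f' g' 0))) =
      toPoly g' (ne hf0') (Φ.symm (Φ (coord f' g' 0))) at h'
    rw [← h, RingEquiv.symm_apply_apply] at h'
    simp only [RingHom.comp_apply, toPoly_coord_zero, coe_eval₂RingHom, eval₂_mul, eval₂_C,
      eval₂_X] at h'
    rw [show φK.symm.toRingHom (φK.toRingHom (algebraMap A K f')) = algebraMap A K f' from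
      φK.symm_apply_apply _] at h'
    exact mul_left_cancel₀ (C_ne_zero.2 (ne hf0')) h'
  have hcomp : (T.map φK.symm.toRingHom).comp S = X := by
    rw [← hST, comp, eval₂_map]
  -- Degrees multiply under composition, so both `T` and `S` are affine.
  have hdeg : T.natDegree * S.natDegree = 1 := by
    have := congrArg natDegree hcomp
    rwa [natDegree_comp, natDegree_map, natDegree_X] at this
  obtain ⟨α, β, rfl⟩ := exists_eq_X_add_C_of_natDegree_le_one
    (Nat.eq_one_of_mul_eq_one_right hdeg).le
  obtain ⟨α', β', rfl⟩ := exists_eq_X_add_C_of_natDegree_le_one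
    (Nat.eq_one_of_mul_eq_one_left hdeg).le
  obtain ⟨a, rfl, ha₀, ha₁⟩ := exists_multiplier (φ := φ.toRingHom) (ne hf0) (ne hg0) (ne hf0')
    hfg hφ (relPrime_map φ hfg') hT
  obtain ⟨b, rfl, hb₀, hb₁⟩ := exists_multiplier (φ := φ.symm.toRingHom) (ne hf0') (ne hg0')
    (ne hf0) hfg' hφs (relPrime_map φ.symm hfg) hS
  have hab : φ.symm a * b = 1 := by
    apply inj
    have := congrArg (fun P => coeff P 1) hcomp
    simpa [hφs] using this
  have hb : IsUnit b := .of_mul_eq_one_right _ hab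
  have ha : IsUnit a := by
    simpa using (IsUnit.of_mul_eq_one _ hab).map φ
  apply le_antisymm
  · rw [Ideal.map_span, Ideal.span_le]
    rintro _ ⟨c, rfl | rfl, rfl⟩
    · exact (Ideal.unit_mul_mem_iff_mem _ ha).1 ha₀
    · exact (Ideal.unit_mul_mem_iff_mem _ ha).1 ha₁
  · rw [Ideal.span_le]
    rintro c hc
    have : φ.symm c ∈ Ideal.span {f', g'} := by
      obtain rfl | rfl := hc
      · exact (Ideal.unit_mul_mem_iff_mem _ hb).1 hb₀
      · exact (Ideal.unit_mul_mem_iff_mem _ hb).1 hb₁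
    simpa using Ideal.mem_map_of_mem φ this

end Comparison

end Algebra

/-! ### Recovering the exponents from `(x ^ m, y ^ n)`. -/

section Exponents

open MvPolynomial

theorem isRelPrime_X : IsRelPrime (X 0 : PlaneRing) (X 1) := by
  rw [Irreducible.isRelPrime_iff_not_dvd (X_prime (i := 0)).irreducible]
  intro h
  rw [X_dvd_X] at h
  simp at h

/-- The maximal ideal of the origin. -/
noncomputable abbrev originIdeal : Ideal PlaneRing := Ideal.span {X 0, X 1}

/-- The ideal `(x ^ m, y ^ n)`. -/
noncomputable abbrev powIdeal (m n : ℕ) : Ideal PlaneRing := Ideal.span {X 0 ^ m, X 1 ^ n}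

theorem mem_originIdeal_iff (a : PlaneRing) : a ∈ originIdeal ↔ constantCoeff a = 0 := by
  constructor
  · intro h
    obtain ⟨b, c, rfl⟩ := Ideal.mem_span_pair.1 h
    simp
  · intro h
    have key : ∀ b : PlaneRing, b - C (constantCoeff b) ∈ originIdeal := by
      intro b
      induction b using MvPolynomial.induction_on with
      | C c => simp
      | add p q hp hq =>
        have := add_mem hp hq
        rwa [sub_add_sub_comm, ← C_add, ← map_add] at this
      | mul_X p i hp =>
        rw [map_mul, constantCoeff_X, mul_zero, C_0, sub_zero]
        refine Ideal.mul_mem_left _ _ (Ideal.subset_span ?_)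
        fin_cases i <;> simp
    simpa [h] using key a

theorem powIdeal_le_originIdeal {m n : ℕ} (hm : 1 ≤ m) (hn : 1 ≤ n) :
    powIdeal m n ≤ originIdeal := by
  rw [Ideal.span_le]
  rintro _ (rfl | rfl)
  · exact Ideal.pow_mem_of_mem _ (Ideal.subset_span (by simp)) _ hm
  · exact Ideal.pow_mem_of_mem _ (Ideal.subset_span (by simp)) _ hn

/-- Pigeonhole: a monomial of degree `m + n + 1` has `x`-exponent above `m` or `y`-exponent above
`n`. -/
theorem originIdeal_pow_le (m n : ℕ) :
    originIdeal ^ (m + n + 1) ≤ powIdeal (m + 1) (n + 1) := by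
  rw [originIdeal, powIdeal, Ideal.span_insert, Ideal.span_insert, ← Ideal.span_singleton_pow,
    ← Ideal.span_singleton_pow, ← Ideal.add_eq_sup, ← Ideal.add_eq_sup, add_pow, Ideal.sum_eq_sup]
  refine Finset.sup_le fun i hi => ?_
  by_cases h : m + 1 ≤ i
  · exact Ideal.mul_le_left.trans (Ideal.mul_le_left.trans
      ((Ideal.pow_le_pow_right h).trans le_sup_left))
  · exact Ideal.mul_le_left.trans (Ideal.mul_le_right.trans
      ((Ideal.pow_le_pow_right (by lia)).trans le_sup_right))

/-- The witness is `x ^ m * y ^ n`: were it in the ideal, cancelling it would put `1` in `(x, y)`.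
-/
theorem add_lt_of_originIdeal_pow_le {m n k : ℕ} (h : originIdeal ^ k ≤ powIdeal (m + 1) (n + 1)) :
    m + n < k := by
  by_contra! hk
  have hmem : (X 0 ^ m * X 1 ^ n : PlaneRing) ∈ originIdeal ^ k := by
    refine Ideal.pow_le_pow_right hk ?_
    rw [pow_add]
    exact Ideal.mul_mem_mul (Ideal.pow_mem_pow (Ideal.subset_span (by simp)) _)
      (Ideal.pow_mem_pow (Ideal.subset_span (by simp)) _)
  obtain ⟨a, b, hab⟩ := Ideal.mem_span_pair.1 (h hmem)
  have h₁ : (X 0 ^ m : PlaneRing) ∣ b :=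
    (isRelPrime_X.pow (m := m) (n := n + 1)).dvd_of_dvd_mul_right
      ⟨X 1 ^ n - a * X 0, by linear_combination hab⟩
  have h₂ : (X 1 ^ n : PlaneRing) ∣ a :=
    (isRelPrime_X.pow (m := m + 1) (n := n)).symm.dvd_of_dvd_mul_right
      ⟨X 0 ^ m - b * X 1, by linear_combination hab⟩
  obtain ⟨c, rfl⟩ := h₁
  obtain ⟨d, rfl⟩ := h₂
  have h₃ : d * X 0 + c * X 1 = (1 : PlaneRing) := by
    refine mul_left_cancel₀ (mul_ne_zero (pow_ne_zero m (X_ne_zero 0))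
      (pow_ne_zero n (X_ne_zero 1))) ?_
    linear_combination hab
  simpa using congrArg constantCoeff h₃

theorem powIdeal_le_originIdeal_pow (m n : ℕ) : powIdeal m n ≤ originIdeal ^ min m n := by
  rw [Ideal.span_le]
  rintro _ (rfl | rfl)
  · exact Ideal.pow_le_pow_right (min_le_left _ _)
      (Ideal.pow_mem_pow (Ideal.subset_span (by simp)) _)
  · exact Ideal.pow_le_pow_right (min_le_right _ _)
      (Ideal.pow_mem_pow (Ideal.subset_span (by simp)) _)

theorem le_of_X_pow_mem_originIdeal_pow {i : Fin 2} {m k : ℕ}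
    (h : (X i ^ m : PlaneRing) ∈ originIdeal ^ k) : k ≤ m := by
  -- Restriction to the diagonal `x = y = t` turns the ideal of the origin into `(t)`.
  let d : PlaneRing →+* Polynomial ℂ := (aeval fun _ => Polynomial.X : PlaneRing →ₐ[ℂ] _).toRingHom
  have hd : ∀ i, d (X i) = Polynomial.X := fun i => by simp [d]
  have h' := Ideal.mem_map_of_mem d h
  rw [Ideal.map_pow, Ideal.map_span, Set.image_pair, hd, hd, Set.pair_eq_singleton, map_pow, hd,
    Ideal.span_singleton_pow, Ideal.mem_span_singleton] at h'
  exact (pow_dvd_pow_iff Polynomial.X_ne_zero Polynomial.not_isUnit_X).1 h'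

/-- Powers of `φ x` and `φ y` vanish at the origin, hence so do `φ x` and `φ y`. -/
theorem map_originIdeal_le {m n p q : ℕ} (hm : 1 ≤ m) (hn : 1 ≤ n) (φ : PlaneRing ≃+* PlaneRing)
    (h : Ideal.map φ (powIdeal p q) = powIdeal m n) : Ideal.map φ originIdeal ≤ originIdeal := by
  have hmem : ∀ a ∈ powIdeal p q, φ a ∈ originIdeal := fun a ha =>
    powIdeal_le_originIdeal hm hn (h ▸ Ideal.mem_map_of_mem φ ha)
  have hpow : ∀ (a : PlaneRing) (k : ℕ), φ (a ^ k) ∈ originIdeal → φ a ∈ originIdeal := by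
    intro a k h
    rw [mem_originIdeal_iff, map_pow, map_pow] at h
    exact (mem_originIdeal_iff _).2 (eq_zero_of_pow_eq_zero h)
  rw [Ideal.map_span, Ideal.span_le]
  rintro _ ⟨c, rfl | rfl, rfl⟩
  · exact hpow _ p (hmem _ (Ideal.subset_span (by simp)))
  · exact hpow _ q (hmem _ (Ideal.subset_span (by simp)))

theorem add_le_and_min_le_of_map_powIdeal {m n p q : ℕ} (hm : 1 ≤ m) (hn : 1 ≤ n) (hp : 1 ≤ p)
    (hq : 1 ≤ q) (φ : PlaneRing ≃+* PlaneRing)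
    (h : Ideal.map φ (powIdeal p q) = powIdeal m n) : m + n ≤ p + q ∧ min p q ≤ min m n := by
  have hinv : ∀ I : Ideal PlaneRing, Ideal.map φ (Ideal.map φ.symm I) = I := fun I => by
    rw [Ideal.map_symm, Ideal.map_comap_of_surjective φ φ.surjective]
  have hs : Ideal.map φ.symm (powIdeal m n) = powIdeal p q := by
    rw [← h, Ideal.map_symm, Ideal.comap_map_of_bijective φ φ.bijective]
  have hM : Ideal.map φ originIdeal = originIdeal := by
    refine le_antisymm (map_originIdeal_le hm hn φ h) ?_
    have := Ideal.map_mono (f := φ) (map_originIdeal_le hp hq φ.symm hs)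
    rwa [hinv] at this
  constructor
  · obtain ⟨m, rfl⟩ := Nat.exists_eq_add_of_le' hm
    obtain ⟨n, rfl⟩ := Nat.exists_eq_add_of_le' hn
    obtain ⟨p, rfl⟩ := Nat.exists_eq_add_of_le' hp
    obtain ⟨q, rfl⟩ := Nat.exists_eq_add_of_le' hq
    have := Ideal.map_mono (f := φ) (originIdeal_pow_le p q)
    rw [Ideal.map_pow, hM, h] at this
    have := add_lt_of_originIdeal_pow_le this
    lia
  · have := Ideal.map_mono (f := φ) (powIdeal_le_originIdeal_pow p q)
    rw [Ideal.map_pow, hM, h] at this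
    exact le_min (le_of_X_pow_mem_originIdeal_pow (i := 0) (this (Ideal.subset_span (by simp))))
      (le_of_X_pow_mem_originIdeal_pow (i := 1) (this (Ideal.subset_span (by simp))))

theorem pair_eq_of_map_powIdeal {m n p q : ℕ} (hm : 1 ≤ m) (hn : 1 ≤ n) (hp : 1 ≤ p)
    (hq : 1 ≤ q) (φ : PlaneRing ≃+* PlaneRing)
    (h : Ideal.map φ (powIdeal p q) = powIdeal m n) : ({m, n} : Set ℕ) = {p, q} := by
  have hs : Ideal.map φ.symm (powIdeal m n) = powIdeal p q := by
    rw [← h, Ideal.map_symm, Ideal.comap_map_of_bijective φ φ.bijective]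
  obtain ⟨h₁, h₂⟩ := add_le_and_min_le_of_map_powIdeal hm hn hp hq φ h
  obtain ⟨h₃, h₄⟩ := add_le_and_min_le_of_map_powIdeal hp hq hm hn φ.symm hs
  rw [Set.pair_eq_pair_iff]
  lia

end Exponents

/-! ### Extending sections across codimension two. -/

section Hartogs

open PrimeSpectrum IsAffineOpen

variable {R : CommRingCat}

theorem algebraMap_section_injective [IsDomain R] (U : (Spec R).Opens)
    (hU : (⊥ : PrimeSpectrum R) ∈ U) :
    Function.Injective (algebraMap R Γ(Spec R, U)) := by
  have : Nonempty U := ⟨⟨_, hU⟩⟩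
  have h := map_injective_of_isIntegral (Spec R) (homOfLE (le_top : U ≤ ⊤))
  rw [algebraMap_Spec_obj, CommRingCat.hom_comp, RingHom.coe_comp]
  exact h.comp (ConcreteCategory.bijective_of_isIso (Scheme.ΓSpecIso R).inv).1

theorem map_algebraMap_section {U V : (Spec R).Opens} (i : V ⟶ U)
    (a : R) :
    (Spec R).presheaf.map i.op
      (algebraMap R Γ(Spec R, U) a) =
    algebraMap R Γ(Spec R, V) a := by
  simp only [algebraMap_Spec_obj, CommRingCat.hom_comp, RingHom.comp_apply]
  rw [← CommRingCat.comp_apply, ← Functor.map_comp]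
  rfl

/-- A section over `D(f) ∪ D(g)`, with `f` and `g` coprime, extends to the whole spectrum. -/
theorem algebraMap_section_bijective [IsDomain R] [DecompositionMonoid R] {f g : R} (hf : f ≠ 0)
    (hg : g ≠ 0) (hfg : IsRelPrime f g) (U : (Spec R).Opens)
    (hU : U = basicOpen f ⊔ basicOpen g) :
    Function.Bijective (algebraMap R Γ(Spec R, U)) := by
  have mem : ∀ {a : R}, a ≠ 0 → (⊥ : PrimeSpectrum R) ∈ basicOpen a := fun h => h
  let bf : (Spec R).Opens := basicOpen f
  let bg : (Spec R).Opens := basicOpen g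
  have hfU : bf ≤ U := hU ▸ le_sup_left
  have hgU : bg ≤ U := hU ▸ le_sup_right
  refine ⟨algebraMap_section_injective U (hfU (mem hf)), fun s => ?_⟩
  obtain ⟨k, a, ha⟩ := IsLocalization.Away.surj (S := Γ(Spec R, bf)) f
    ((Spec R).presheaf.map (homOfLE hfU).op s)
  obtain ⟨l, b, hb⟩ := IsLocalization.Away.surj (S := Γ(Spec R, bg)) g
    ((Spec R).presheaf.map (homOfLE hgU).op s)
  have ha' := congrArg ((Spec R).presheaf.map
    (homOfLE (inf_le_left : bf ⊓ bg ≤ bf)).op) ha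
  have hb' := congrArg ((Spec R).presheaf.map
    (homOfLE (inf_le_right : bf ⊓ bg ≤ bg)).op) hb
  simp only [map_mul, map_pow, map_algebraMap_section] at ha' hb'
  rw [← CommRingCat.comp_apply, ← Functor.map_comp] at ha' hb'
  have hinj := algebraMap_section_injective (bf ⊓ bg) ⟨mem hf, mem hg⟩
  -- The local expressions `a / f ^ k` and `b / g ^ l` agree on the overlap; coprimality then makes
  -- both equal to one element of `R`.
  have heq : a * g ^ l = b * f ^ k := by
    apply hinj
    rw [map_mul, map_mul, map_pow, map_pow, ← ha', ← hb']
    exact mul_right_comm _ _ _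
  obtain ⟨c, rfl⟩ : f ^ k ∣ a :=
    (hfg.pow (m := k) (n := l)).dvd_of_dvd_mul_right ⟨b, by rw [heq, mul_comm]⟩
  obtain rfl : b = c * g ^ l :=
    mul_right_cancel₀ (pow_ne_zero k hf) (by rw [← heq]; ring)
  refine ⟨c, ((Spec R).sheaf.eq_of_locally_eq₂ (homOfLE hfU) (homOfLE hgU) hU.le s
    (algebraMap R Γ(Spec R, U) c) ?_ ?_).symm⟩
  · refine Eq.trans ?_ (map_algebraMap_section _ _).symm
    have hu := IsLocalization.Away.algebraMap_isUnit (S := Γ(Spec R, bf)) f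
    refine (hu.pow k).mul_right_cancel (ha.trans ?_)
    rw [map_mul, map_pow, mul_comm]
  · refine Eq.trans ?_ (map_algebraMap_section _ _).symm
    have hu := IsLocalization.Away.algebraMap_isUnit (S := Γ(Spec R, bg)) g
    refine (hu.pow l).mul_right_cancel (hb.trans ?_)
    rw [map_mul, map_pow]

end Hartogs

/-! ### From schemes to coordinate rings. -/

section Geometry

theorem mem_puncturedOpen (p : PrimeSpectrum PlaneRing) :
    (show plane from p) ∈ puncturedOpen ↔
      MvPolynomial.X 0 ∉ p.asIdeal ∨ MvPolynomial.X 1 ∉ p.asIdeal := by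
  change ¬ ({MvPolynomial.X 0, MvPolynomial.X 1} : Set PlaneRing) ⊆ p.asIdeal ↔ _
  rw [Set.insert_subset_iff, Set.singleton_subset_iff, not_and_or]
  rfl

theorem puncturedOpen_eq :
    puncturedOpen = PrimeSpectrum.basicOpen (MvPolynomial.X 0 : PlaneRing) ⊔
      PrimeSpectrum.basicOpen (MvPolynomial.X 1 : PlaneRing) := by
  ext p
  exact mem_puncturedOpen p

instance isIso_ι_appTop : IsIso puncturedOpen.ι.appTop := by
  have : IsDomain (CommRingCat.of PlaneRing) := inferInstanceAs (IsDomain PlaneRing)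
  have : DecompositionMonoid (CommRingCat.of PlaneRing) :=
    inferInstanceAs (DecompositionMonoid PlaneRing)
  have h := algebraMap_section_bijective (R := CommRingCat.of PlaneRing)
    (MvPolynomial.X_ne_zero 0) (MvPolynomial.X_ne_zero 1) isRelPrime_X puncturedOpen
    puncturedOpen_eq
  have h' : IsIso ((Scheme.ΓSpecIso (CommRingCat.of PlaneRing)).inv ≫
      plane.presheaf.map (homOfLE (le_top : puncturedOpen ≤ ⊤)).op) :=
    (ConcreteCategory.isIso_iff_bijective _).2 h
  have h'' := IsIso.of_isIso_comp_left (Scheme.ΓSpecIso (CommRingCat.of PlaneRing)).inv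
      (plane.presheaf.map (homOfLE (le_top : puncturedOpen ≤ ⊤)).op)
  have e : puncturedOpen.ι.appTop ≫ puncturedOpen.topIso.hom =
      plane.presheaf.map (homOfLE (le_top : puncturedOpen ≤ ⊤)).op := by
    simp only [Scheme.Opens.ι_appTop, Scheme.Opens.topIso_hom]
    exact (plane.presheaf.map_comp _ _).symm
  rw [← e] at h''
  exact IsIso.of_isIso_comp_right _ puncturedOpen.topIso.hom

theorem TorsorRing.notMem_or_notMem {A : Type*} [CommRing A] {f g : A}
    (P : Ideal (TorsorRing f g)) (hP : P ≠ ⊤) :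
    f ∉ P.comap (algebraMap A _) ∨ g ∉ P.comap (algebraMap A _) := by
  by_contra! h
  refine hP ((Ideal.eq_top_iff_one _).2 ?_)
  rw [← TorsorRing.relation f g]
  exact sub_mem (Ideal.mul_mem_right _ _ h.1) (Ideal.mul_mem_right _ _ h.2)

/-- The equation has no solution over the origin, so restricting to the punctured plane removes
nothing and the total space is affine. -/
theorem projection_preimage {m n : ℕ} (hm : 1 ≤ m) (hn : 1 ≤ n) :
    projection m n ⁻¹ᵁ puncturedOpen = ⊤ := by
  rw [eq_top_iff]
  intro p _
  let r : PrimeSpectrum PlaneRing :=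
    PrimeSpectrum.comap (algebraMap PlaneRing (BundleRing m n)) p
  refine (mem_puncturedOpen r).2 ?_
  have h : MvPolynomial.X 0 ^ m ∉ r.asIdeal ∨ MvPolynomial.X 1 ^ n ∉ r.asIdeal :=
    TorsorRing.notMem_or_notMem (PrimeSpectrum.asIdeal p) (PrimeSpectrum.isPrime p).ne_top
  exact h.imp (fun h h' => h (Ideal.pow_mem_of_mem _ h' _ hm))
    (fun h h' => h (Ideal.pow_mem_of_mem _ h' _ hn))

theorem isIso_appTop {X Y : Scheme} (f : X ⟶ Y) [IsIso f] : IsIso f.appTop :=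
  inferInstanceAs (IsIso (f.app ⊤))

theorem isIso_totalSpace_ι {m n : ℕ} (hm : 1 ≤ m) (hn : 1 ≤ n) :
    IsIso (projection m n ⁻¹ᵁ puncturedOpen).ι := by
  rw [projection_preimage hm hn]
  exact inferInstanceAs (IsIso (Scheme.topIso _).hom)

/-- The regular functions on the punctured plane are the polynomials. -/
noncomputable def planeIso : CommRingCat.of PlaneRing ≅ Γ(puncturedPlane, ⊤) :=
  (Scheme.ΓSpecIso _).symm ≪≫ asIso puncturedOpen.ι.appTop

/-- The coordinate ring of `X_{m,n}`. -/
noncomputable def bundleIso {m n : ℕ} (hm : 1 ≤ m) (hn : 1 ≤ n) :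
    CommRingCat.of (BundleRing m n) ≅ Γ(totalSpace m n, ⊤) :=
  have := isIso_totalSpace_ι hm hn
  have := isIso_appTop (projection m n ⁻¹ᵁ puncturedOpen).ι
  (Scheme.ΓSpecIso _).symm ≪≫ asIso (projection m n ⁻¹ᵁ puncturedOpen).ι.appTop

theorem algebraMap_bundleIso {m n : ℕ} (hm : 1 ≤ m) (hn : 1 ≤ n) :
    CommRingCat.ofHom (algebraMap PlaneRing (BundleRing m n)) ≫ (bundleIso hm hn).hom =
      planeIso.hom ≫ (bundleMap m n).appTop := by
  have h : bundleMap m n ≫ puncturedOpen.ι =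
      (projection m n ⁻¹ᵁ puncturedOpen).ι ≫ projection m n := morphismRestrict_ι _ _
  have h' := congrArg Scheme.Hom.appTop h
  rw [Scheme.Hom.comp_appTop, Scheme.Hom.comp_appTop] at h'
  simp only [bundleIso, planeIso, Iso.trans_hom, Iso.symm_hom, asIso_hom, Category.assoc]
  rw [h', Scheme.ΓSpecIso_inv_naturality_assoc]
  rfl

/-- The isomorphisms of coordinate rings induced by a base change along an automorphism. -/
theorem exists_iso_of_isBaseChangeByAut {m n p q : ℕ} (hm : 1 ≤ m) (hn : 1 ≤ n)
    (hp : 1 ≤ p) (hq : 1 ≤ q) (h : IsBaseChangeByAut (bundleMap m n) (bundleMap p q)) :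
    ∃ (φ : CommRingCat.of PlaneRing ≅ CommRingCat.of PlaneRing)
      (Φ : CommRingCat.of (BundleRing p q) ≅ CommRingCat.of (BundleRing m n)),
      CommRingCat.ofHom (algebraMap PlaneRing (BundleRing p q)) ≫ Φ.hom =
        φ.hom ≫ CommRingCat.ofHom (algebraMap PlaneRing (BundleRing m n)) := by
  obtain ⟨ψ, -, Ψ, hΨ⟩ := h
  have : IsIso Ψ := hΨ.isIso_fst_of_isIso
  have := isIso_appTop Ψ
  have := isIso_appTop ψ.hom
  have hw := congrArg Scheme.Hom.appTop hΨ.w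
  rw [Scheme.Hom.comp_appTop, Scheme.Hom.comp_appTop] at hw
  refine ⟨planeIso ≪≫ asIso ψ.hom.appTop ≪≫ planeIso.symm,
    bundleIso hp hq ≪≫ asIso Ψ.appTop ≪≫ (bundleIso hm hn).symm, ?_⟩
  rw [← cancel_mono (bundleIso hm hn).hom]
  simp only [Iso.trans_hom, Iso.symm_hom, asIso_hom, Category.assoc, Iso.inv_hom_id,
    Category.comp_id, algebraMap_bundleIso, Iso.inv_hom_id_assoc]
  rw [← hw, ← Category.assoc, algebraMap_bundleIso, Category.assoc]

theorem exists_ringEquiv_of_isBaseChangeByAut {m n p q : ℕ} (hm : 1 ≤ m) (hn : 1 ≤ n)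
    (hp : 1 ≤ p) (hq : 1 ≤ q) (h : IsBaseChangeByAut (bundleMap m n) (bundleMap p q)) :
    ∃ (φ : PlaneRing ≃+* PlaneRing) (Φ : BundleRing p q ≃+* BundleRing m n),
      ∀ a, Φ (algebraMap PlaneRing _ a) = algebraMap PlaneRing _ (φ a) := by
  obtain ⟨φ, Φ, h⟩ := exists_iso_of_isBaseChangeByAut hm hn hp hq h
  exact ⟨φ.commRingCatIsoToRingEquiv, Φ.commRingCatIsoToRingEquiv, ConcreteCategory.congr_hom h⟩

theorem pair_eq_of_isBaseChangeByAut {m n p q : ℕ} (hm : 1 ≤ m) (hn : 1 ≤ n)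
    (hp : 1 ≤ p) (hq : 1 ≤ q) (h : IsBaseChangeByAut (bundleMap m n) (bundleMap p q)) :
    ({m, n} : Set ℕ) = {p, q} := by
  obtain ⟨φ, Φ, hΦ⟩ := exists_ringEquiv_of_isBaseChangeByAut hm hn hp hq h
  have hX : ∀ (i : Fin 2) (k : ℕ), (MvPolynomial.X i ^ k : PlaneRing) ≠ 0 := fun i k =>
    pow_ne_zero k (MvPolynomial.X_ne_zero i)
  exact pair_eq_of_map_powIdeal hm hn hp hq φ
    (TorsorRing.map_span_eq (hX 0 m) (hX 1 n) (hX 0 p) (hX 1 q) isRelPrime_X.pow isRelPrime_X.pow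
      φ Φ hΦ)

/-! ### The converse: exchanging the coordinates. -/

/-- The automorphism of `ℂ[x, y]` exchanging `x` and `y`. -/
noncomputable def swapEquiv : PlaneRing ≃+* PlaneRing :=
  (MvPolynomial.renameEquiv ℂ (Equiv.swap (0 : Fin 2) 1)).toRingEquiv

theorem swapEquiv_X (i : Fin 2) :
    swapEquiv (MvPolynomial.X i) = MvPolynomial.X (Equiv.swap 0 1 i) :=
  MvPolynomial.rename_X _ _

theorem swapEquiv_swapEquiv (a : PlaneRing) : swapEquiv (swapEquiv a) = a := by
  simp [swapEquiv, MvPolynomial.rename_rename, ← Equiv.coe_trans]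

/-- The homomorphism `u ↦ -v`, `v ↦ -u` over a ring homomorphism that sends `f'` to `g` and `g'`
to `f`. -/
noncomputable def TorsorRing.swapHom {A : Type*} [CommRing A] {f g f' g' : A} (e : A →+* A)
    (hf : e f' = g) (hg : e g' = f) : TorsorRing f' g' →+* TorsorRing f g :=
  TorsorRing.lift ((algebraMap A _).comp e) ![-coord f g 1, -coord f g 0] (by
    rw [RingHom.comp_apply, RingHom.comp_apply, hf, hg]
    simp only [Matrix.cons_val_zero, Matrix.cons_val_one]
    linear_combination TorsorRing.relation f g)

theorem TorsorRing.swapHom_algebraMap {A : Type*} [CommRing A] {f g f' g' : A} (e : A →+* A)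
    (hf : e f' = g) (hg : e g' = f) (a : A) :
    swapHom e hf hg (algebraMap A _ a) = algebraMap A _ (e a) := by
  simp [swapHom]

theorem TorsorRing.swapHom_comp_swapHom {A : Type*} [CommRing A] {f g f' g' : A} (e : A →+* A)
    (he : ∀ a, e (e a) = a) (hf : e f' = g) (hg : e g' = f) (hf' : e f = g') (hg' : e g = f') :
    (swapHom e hf hg).comp (swapHom e hf' hg') = RingHom.id (TorsorRing f g) := by
  refine ringHom_ext (fun a => ?_) fun i => ?_
  · rw [RingHom.comp_apply, swapHom_algebraMap, swapHom_algebraMap, he, RingHom.id_apply]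
  · fin_cases i <;> simp [swapHom]

/-- The isomorphism `u ↦ -v`, `v ↦ -u` over an involution that exchanges `f'` with `g` and `g'`
with `f`. -/
noncomputable def TorsorRing.swapEquiv {A : Type*} [CommRing A] {f g f' g' : A} (e : A →+* A)
    (he : ∀ a, e (e a) = a) (hf : e f' = g) (hg : e g' = f) :
    TorsorRing f' g' ≃+* TorsorRing f g :=
  RingEquiv.ofRingHom (swapHom e hf hg) (swapHom e (by rw [← hg, he]) (by rw [← hf, he]))
    (swapHom_comp_swapHom e he ..) (swapHom_comp_swapHom e he ..)

/-- The map `(x, y, u, v) ↦ (y, x, -v, -u)` on coordinate rings. -/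
noncomputable def bundleSwap (m n : ℕ) : BundleRing n m ≃+* BundleRing m n :=
  TorsorRing.swapEquiv (f' := (MvPolynomial.X 0 ^ n : PlaneRing)) (g' := MvPolynomial.X 1 ^ m)
    (f := (MvPolynomial.X 0 ^ m : PlaneRing)) (g := MvPolynomial.X 1 ^ n)
    swapEquiv.toRingHom swapEquiv_swapEquiv (by simp [swapEquiv_X]) (by simp [swapEquiv_X])

theorem bundleSwap_algebraMap (m n : ℕ) (a : PlaneRing) :
    bundleSwap m n (algebraMap PlaneRing _ a) = algebraMap PlaneRing _ (swapEquiv a) :=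
  TorsorRing.swapHom_algebraMap (f' := (MvPolynomial.X 0 ^ n : PlaneRing))
    (g' := MvPolynomial.X 1 ^ m) _ (by simp [swapEquiv_X]) (by simp [swapEquiv_X]) a

/-- The involution `(x, y) ↦ (y, x)` of the plane. -/
noncomputable def planeSwap : plane ⟶ plane :=
  Spec.map (CommRingCat.ofHom swapEquiv.toRingHom)

theorem planeSwap_planeSwap : planeSwap ≫ planeSwap = 𝟙 _ := by
  rw [planeSwap, ← Spec.map_comp, ← Spec.map_id]
  congr 1
  refine CommRingCat.hom_ext (RingHom.ext fun a => ?_)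
  exact swapEquiv_swapEquiv a

theorem planeSwap_preimage : planeSwap ⁻¹ᵁ puncturedOpen = puncturedOpen := by
  ext p
  refine (mem_puncturedOpen (PrimeSpectrum.comap swapEquiv.toRingHom p)).trans
    (Iff.trans ?_ (mem_puncturedOpen p).symm)
  change swapEquiv _ ∉ p.asIdeal ∨ swapEquiv _ ∉ p.asIdeal ↔ _
  rw [swapEquiv_X, swapEquiv_X, or_comm]
  simp

/-- The involution `(x, y) ↦ (y, x)` of the punctured plane. -/
noncomputable def puncturedSwap : puncturedPlane ≅ puncturedPlane where
  hom := planeSwap.resLE puncturedOpen puncturedOpen planeSwap_preimage.ge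
  inv := planeSwap.resLE puncturedOpen puncturedOpen planeSwap_preimage.ge
  hom_inv_id := by
    rw [← cancel_mono puncturedOpen.ι]
    simp [planeSwap_planeSwap]
  inv_hom_id := by
    rw [← cancel_mono puncturedOpen.ι]
    simp [planeSwap_planeSwap]

theorem puncturedSwap_structureMap : puncturedSwap.hom ≫ structureMap = structureMap := by
  rw [structureMap, puncturedSwap, Scheme.Hom.resLE_comp_ι_assoc, planeSwap, ← Spec.map_comp]
  congr 2
  refine CommRingCat.hom_ext (RingHom.ext fun a => ?_)
  exact MvPolynomial.rename_C _ a

theorem isPullback_projection_swap (m n : ℕ) :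
    IsPullback (Spec.map (bundleSwap m n).toCommRingCatIso.hom) (projection m n)
      (projection n m) planeSwap := by
  have : IsIso planeSwap := ⟨_, planeSwap_planeSwap, planeSwap_planeSwap⟩
  refine IsPullback.of_horiz_isIso ⟨?_⟩
  rw [projection, projection, planeSwap, ← Spec.map_comp, ← Spec.map_comp]
  congr 1
  refine CommRingCat.hom_ext (RingHom.ext fun a => ?_)
  exact bundleSwap_algebraMap m n a

theorem isBaseChangeByAut_refl (m n : ℕ) :
    IsBaseChangeByAut (bundleMap m n) (bundleMap m n) :=
  ⟨Iso.refl _, Category.id_comp _, 𝟙 _, IsPullback.of_horiz_isIso ⟨by simp⟩⟩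

theorem isBaseChangeByAut_swap (m n : ℕ) :
    IsBaseChangeByAut (bundleMap m n) (bundleMap n m) := by
  refine ⟨puncturedSwap, puncturedSwap_structureMap, ?_⟩
  have h := Scheme.Hom.isPullback_resLE (isPullback_projection_swap m n)
    (US := puncturedOpen) (UT := puncturedOpen) (UX := projection n m ⁻¹ᵁ puncturedOpen)
    (UY := projection m n ⁻¹ᵁ puncturedOpen) planeSwap_preimage.ge le_rfl (by
      rw [← Scheme.Hom.comp_preimage, (isPullback_projection_swap m n).w,
        Scheme.Hom.comp_preimage, planeSwap_preimage, inf_idem])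
  rw [Scheme.Hom.resLE_eq_morphismRestrict, Scheme.Hom.resLE_eq_morphismRestrict] at h
  exact ⟨_, h⟩

end Geometry
end PuncturedPlane

theorem mainTheorem6 (m n p q : ℕ) (hm : 1 ≤ m) (hn : 1 ≤ n) (hp : 1 ≤ p) (hq : 1 ≤ q) :
    PuncturedPlane.IsBaseChangeByAut
        (PuncturedPlane.bundleMap m n) (PuncturedPlane.bundleMap p q) ↔
      ({m, n} : Set ℕ) = {p, q} := by
  refine ⟨PuncturedPlane.pair_eq_of_isBaseChangeByAut hm hn hp hq, fun h => ?_⟩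
  obtain ⟨rfl, rfl⟩ | ⟨rfl, rfl⟩ := Set.pair_eq_pair_iff.1 h
  · exact PuncturedPlane.isBaseChangeByAut_refl m n
  · exact PuncturedPlane.isBaseChangeByAut_swap m n
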